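/- Let $\Omega\subseteq\mathbb R^3_x\times\mathbb R^3_v$ be open with connected position projection $X=\{x:(x,v)\in\Omega\text{ for some }v\}$; the case of all of phase space is $\Omega=\mathbb R^3\times\mathbb R^3$, $X=\mathbb R^3$. Definitions. For a $C^1$ potential $\Phi:\mathbb R^3\to\mathbb R$ put $E_\Phi(x,v)=\tfrac12|v|^2+\Phi(x)$. A steady-state distribution function in $\Phi$ on $\Omega$ is a $C^1$ function $f$ on $\Omega$ with $\langle v,\nabla_x f\rangle-\langle\nabla\Phi,\nabla_v f\rangle=0$. An action-angle chart of $\Phi$ in $\Omega$ consists of an open set $D\subseteq\mathbb R^3$ and a $C^1$ canonical map $T:(\theta,J)\mapsto(x,v)$, $\theta\in\mathbb R^3$, $J\in D$ (it carries $\sum dx_i\wedge dv_i$ to $\sum d\theta_i\wedge dJ_i$), with values in $\Omega$, such that $T(\theta,J)=T(\theta',J')$ if and only if $J=J'$ and $\theta-\theta'\in 2\pi\mathbb Z^3$, and such that $E_\Phi\circ T=\mathcal E(J)$ depends on $J$ only. The torus $T(\cdot,J)$ is nonresonant if $\langle k,\nabla\mathcal E(J)\rangle\ne0$ for all $k\in\mathbb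 Z^3\setminus\{0\}$. The potential $\Phi$ is integrable on $\Omega$ if almost every point of $\Omega$ lies on a nonresonant torus of some action-angle chart of $\Phi$ in $\Omega$. Functions $f_1,\dots,f_4$ are independent at a point $p$ if no nontrivial linear combination of them vanishes at $p$ together with its differential (where $f_1\neq0$: if the differentials of $f_i/f_1$, $i=2,3,4$, are linearly independent at $p$). Theorem 2 (bias-function uniqueness). Let $\Phi$ be a $C^1$ potential that is integrable on $\Omega$, let $f_1,\dots,f_4$ be steady-state distribution functions in $\Phi$ on $\Omega$, let $0<\gamma\le1$ on $\Omega$ be an arbitrary bias function, and let $g_i=\gamma f_i>0$ on $\Omega$, $i=1,\dots,4$. Assume that the $f_i$ are independent in the sense that the set of those $x$ for which $f_1,\dots,f_4$ are independent at some $(x,v)\in\Omega$ is dense in $X$. Then: (a) $g_i/g_1=f_i/f_1$ on $\Omega$ for $i=2,3,4$; (b) in every action-angle chart of $\Phi$ in $\Omega$ these three ratios are functions of $J$ alone on the nonresonant tori; (c) the three ratios determine $\Phi$ uniquely on $X$ up to an additive constant: if $\Psi$ is any $C^1$ potential that is integrable on $\Omega$, $0<\gamma'\le1$ any bias function on $\Omega$,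 and $f'_1,\dots,f'_4$ any steady-state distribution functions in $\Psi$ on $\Omega$ with $g'_i=\gamma'f'_i>0$ and $g'_i/g'_1=g_i/g_1$ on $\Omega$ for $i=2,3,4$, then $\Psi-\Phi$ is constant on $X$. -/

import Mathlib

open MeasureTheory

noncomputable section

/-- Three-dimensional Euclidean space (positions, velocities, angles, actions). -/
abbrev Space3 : Type := EuclideanSpace ℝ (Fin 3)

/-- Phase space: pairs `(x, v)` of a position and a velocity; also used for the pairs
`(θ, J)` of angles and actions. The first entry is the coordinate, the second the momentum. -/
abbrev Phase : Type := Space3 × Space3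

/-- The canonical symplectic form `∑ dqᵢ ∧ dpᵢ` on pairs `(q, p)`. -/
def symplecticForm (u w : Phase) : ℝ :=
  inner ℝ u.1 w.2 - inner ℝ u.2 w.1

/-- The energy `E(x, v) = |v|² / 2 + Φ(x)`. -/
def energy (Φ : Space3 → ℝ) (p : Phase) : ℝ :=
  (1 / 2) * inner ℝ p.2 p.2 + Φ p.1

/-- A steady-state distribution function in the potential `Φ` on the phase-space domain `Ω`:
a continuously differentiable stationary solution of the collisionless Boltzmann equation
`⟨v, ∇ₓ f⟩ - ⟨∇Φ, ∇ᵥ f⟩ = 0`, the left side being the derivative of `f` in the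
direction `(v, -∇Φ(x))`. -/
structure IsSteadyState (Φ : Space3 → ℝ) (Ω : Set Phase) (f : Phase → ℝ) : Prop where
  contDiffOn : ContDiffOn ℝ 1 f Ω
  boltzmann : ∀ p ∈ Ω, fderiv ℝ f p (p.2, -gradient Φ p.1) = 0

/-- Action-angle coordinates for the motion in the potential `Φ` on a part of `Ω`.
For each `J` in the open set `actions`, the map `θ ↦ toPhase (θ, J)` parametrizes a 3-torus in
`Ω` by angles modulo `2π`; distinct `J` give disjoint tori; the transformation
`(θ, J) ↦ (x, v)` is canonical and the energy depends on `J` only. -/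
structure ActionAngleChart (Φ : Space3 → ℝ) (Ω : Set Phase) where
  actions : Set Space3
  isOpen_actions : IsOpen actions
  toPhase : Phase → Phase
  contDiffOn : ContDiffOn ℝ 1 toPhase (Set.univ ×ˢ actions)
  mapsTo : ∀ θ, ∀ J ∈ actions, toPhase (θ, J) ∈ Ω
  torus : ∀ θ θ', ∀ J ∈ actions, ∀ J' ∈ actions,
    toPhase (θ, J) = toPhase (θ', J') ↔
      J = J' ∧ ∃ k : Fin 3 → ℤ, ∀ i, θ' i = θ i + 2 * Real.pi * (k i : ℝ)
  canonical : ∀ θ, ∀ J ∈ actions, ∀ u w : Phase,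
    symplecticForm (fderiv ℝ toPhase (θ, J) u) (fderiv ℝ toPhase (θ, J) w) =
      symplecticForm u w
  energyOfActions : Space3 → ℝ
  energy_eq : ∀ θ, ∀ J ∈ actions, energy Φ (toPhase (θ, J)) = energyOfActions J

/-- The frequency vector `∂E/∂J` of the motion on the torus with actions `J`. -/
def ActionAngleChart.frequency {Φ : Space3 → ℝ} {Ω : Set Phase} (A : ActionAngleChart Φ Ω)
    (J : Space3) : Space3 :=
  gradient A.energyOfActions J

/-- A frequency vector is nonresonant if its components are rationally independent. -/
def Nonresonant (ω : Space3) : Prop :=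
  ∀ k : Fin 3 → ℤ, k ≠ 0 → ∑ i, (k i : ℝ) * ω i ≠ 0

/-- `Φ` generates an integrable system on `Ω`: almost every point of `Ω` lies on a nonresonant
invariant 3-torus of a family of tori in `Ω` described by action-angle coordinates. -/
def IsIntegrableSystem (Φ : Space3 → ℝ) (Ω : Set Phase) : Prop :=
  ∀ᵐ p : Phase, p ∈ Ω →
    ∃ A : ActionAngleChart Φ Ω, ∃ θ : Space3, ∃ J ∈ A.actions,
      Nonresonant (A.frequency J) ∧ A.toPhase (θ, J) = p

/-- The four functions `f i` are independent (to first order, up to a common factor) at `p`: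
no nontrivial linear combination of them vanishes at `p` together with its differential.
Where `f 0` is nonzero this says that the differentials of the three ratios
`f i / f 0`, `i = 1, 2, 3`, are linearly independent at `p`. -/
def IndependentAt (f : Fin 4 → Phase → ℝ) (p : Phase) : Prop :=
  LinearIndependent ℝ (fun i => ((f i p, fderiv ℝ (f i) p) : ℝ × (Phase →L[ℝ] ℝ)))

/-- The positions that occur in the phase-space domain `Ω`. -/
def accessible (Ω : Set Phase) : Set Space3 := Prod.fst '' Ω

/-- The products `g i = γ * f i > 0` on `Ω` of a bias function `0 < γ ≤ 1` and four steady-state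
distribution functions `f i` of matter in an integrable system with potential `Φ`. -/
structure IsBiasedFamily (Ω : Set Phase) (Φ : Space3 → ℝ) (γ : Phase → ℝ)
    (f g : Fin 4 → Phase → ℝ) : Prop where
  potential : ContDiff ℝ 1 Φ
  integrable : IsIntegrableSystem Φ Ω
  bias : ∀ p ∈ Ω, 0 < γ p ∧ γ p ≤ 1
  steady : ∀ i, IsSteadyState Φ Ω (f i)
  product : ∀ i, ∀ p ∈ Ω, g i p = γ p * f i p
  pos : ∀ i, ∀ p ∈ Ω, 0 < g i p

end

/-! The bias cancels in the ratios `f i / f 0`, which are integrals of the motion. On a nonresonant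
torus the motion is a linear flow, so Fourier analysis makes each ratio constant there
(`eq_on_torus_of_integral`), and its differential kills the directions tangent to the torus. Where
the `f i` are independent, the three differentials have a 3-dimensional common kernel: exactly the
tangent space of the torus, which is isotropic (`symplecticForm_eq_zero_of_mem_ker`). If `Ψ` admits
the same ratios, both `(v, -∇Φ)` and `(v, -∇Ψ)` lie in this kernel; their symplectic product is
`±⟨∇Ψ - ∇Φ, v⟩`, so this vanishes. By density it vanishes on an open set of phase points; varying
`v` alone gives `∇Ψ = ∇Φ`, and connectedness gives the constant. -/

/-! ### Nonresonant linear flows on tori. -/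

theorem UnitAddTorus.mFourierCoeff_comp_add_right {d : Type*} [Fintype d]
    (G : UnitAddTorus d → ℂ) (a : UnitAddTorus d) (n : d → ℤ) :
    UnitAddTorus.mFourierCoeff (fun y => G (y + a)) n =
      UnitAddTorus.mFourier n a * UnitAddTorus.mFourierCoeff G n := by
  have hunit : UnitAddTorus.mFourier n a * UnitAddTorus.mFourier (-n) a = 1 := by
    rw [← UnitAddTorus.mFourier_add, add_neg_cancel, UnitAddTorus.mFourier_zero]; rfl
  have hadd : ∀ x y : UnitAddTorus d, UnitAddTorus.mFourier (-n) (x + y) =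
      UnitAddTorus.mFourier (-n) x * UnitAddTorus.mFourier (-n) y := by
    intro x y
    simp [UnitAddTorus.mFourier, fourier_apply, AddCircle.toCircle_add, Finset.prod_mul_distrib]
  have h2 := integral_add_right_eq_self
    (μ := Measure.pi fun _ : d => (AddCircle.haarAddCircle : Measure UnitAddCircle))
    (fun t => UnitAddTorus.mFourier (-n) t • G t) a
  have h3 : UnitAddTorus.mFourierCoeff G n =
    ∫ t, UnitAddTorus.mFourier (-n) t • G t ∂(Measure.pi fun _ : d => (AddCircle.haarAddCircle : Measure UnitAddCircle)) := rfl
  have h4 : UnitAddTorus.mFourierCoeff (fun y => G (y + a)) n =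
    ∫ t, UnitAddTorus.mFourier (-n) t • G (t + a) ∂(Measure.pi fun _ : d => (AddCircle.haarAddCircle : Measure UnitAddCircle)) := rfl
  rw [h3, ← h2, h4, ← integral_const_mul]
  congr 1
  ext t
  rw [hadd, smul_eq_mul, smul_eq_mul]
  linear_combination (-(UnitAddTorus.mFourier (-n) t) * G (t + a)) * hunit

/-- A continuous function on a torus that is invariant under a linear flow with rationally
independent frequencies is constant. -/
theorem UnitAddTorus.eq_of_invariant_of_nonresonant {d : Type*} [Fintype d]
    (G : C(UnitAddTorus d, ℂ)) (ω : d → ℝ) (hω : ∀ k : d → ℤ, k ≠ 0 → ∑ i, (k i : ℝ) * ω i ≠ 0)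
    (hG : ∀ (t : ℝ) (y : UnitAddTorus d), G (y + fun i => ((t * ω i : ℝ) : UnitAddCircle)) = G y)
    (y z : UnitAddTorus d) : G y = G z := by
  have hc : ∀ n : d → ℤ, n ≠ 0 → UnitAddTorus.mFourierCoeff G n = 0 := by
    intro n hn
    obtain ⟨s, hs⟩ : ∃ s, s = ∑ i, (n i : ℝ) * ω i := ⟨_, rfl⟩
    have hs0 : s ≠ 0 := hs ▸ hω n hn
    -- At time `1 / (2 * s)` the `n`-th character of the displacement is `exp(πi) = -1`, so the
    -- coefficient equals its own negative.
    set a : UnitAddTorus d := fun i => (((1 / (2 * s)) * ω i : ℝ) : UnitAddCircle) with ha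
    have h1 := UnitAddTorus.mFourierCoeff_comp_add_right G a n
    have h2 : (fun y => G (y + a)) = G := funext (hG (1 / (2 * s)))
    have h3 : UnitAddTorus.mFourier n a = -1 := by
      have : UnitAddTorus.mFourier n a = ∏ i, fourier (n i) (a i) := rfl
      rw [this]
      simp only [ha, fourier_coe_apply]
      rw [← Complex.exp_sum Finset.univ, ← Complex.exp_pi_mul_I]
      congr 1
      have hs' : (s : ℂ) = ∑ i, (n i : ℂ) * ω i := by rw [hs]; push_cast; rfl
      have hs0' : (s : ℂ) ≠ 0 := by exact_mod_cast hs0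
      have : (∑ i : d, (2 * (Real.pi : ℂ) * Complex.I * (n i : ℂ) * ((1 / (2 * s) * ω i : ℝ) : ℂ) / ((1 : ℝ) : ℂ)))
          = (2 * Real.pi * Complex.I) * (1 / (2 * s)) * ∑ i, (n i : ℂ) * ω i := by
        rw [Finset.mul_sum]
        refine Finset.sum_congr rfl fun i _ => ?_
        push_cast
        ring
      rw [this, ← hs']
      field_simp
    rw [h2, h3] at h1
    linear_combination (1 / 2 : ℂ) * h1
  have hsum : Summable (UnitAddTorus.mFourierCoeff G) :=
    summable_of_ne_finset_zero (s := {0}) fun n hn => hc n (by simpa using hn)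
  have hval : ∀ x, G x = UnitAddTorus.mFourierCoeff G 0 := by
    intro x
    have h := UnitAddTorus.hasSum_mFourier_series_apply_of_summable hsum x
    have h' := hasSum_single (f := fun i : d → ℤ => UnitAddTorus.mFourierCoeff G i • UnitAddTorus.mFourier i x)
      0 (fun n hn => by simp [hc n hn])
    rw [h.unique h', UnitAddTorus.mFourier_zero]
    simp
  rw [hval, hval]

/-- A continuous function on `ℝᵈ` with period lattice `ℤᵈ` that is invariant under a linear flow
with rationally independent frequencies is constant. -/
theorem eq_of_periodic_of_invariant_of_nonresonant {d : Type*} [Fintype d]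
    (F : (d → ℝ) → ℂ) (hF : Continuous F) (hper : ∀ (θ : d → ℝ) (k : d → ℤ), F (fun i => θ i + k i) = F θ)
    (ω : d → ℝ) (hω : ∀ k : d → ℤ, k ≠ 0 → ∑ i, (k i : ℝ) * ω i ≠ 0)
    (hinv : ∀ (t : ℝ) (θ : d → ℝ), F (fun i => θ i + t * ω i) = F θ) (θ θ' : d → ℝ) :
    F θ = F θ' := by
  let q : C(d → ℝ, UnitAddTorus d) := ⟨fun x i => (x i : UnitAddCircle), by fun_prop⟩
  -- A quotient map lets `F` descend to a continuous function on the torus.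
  have hq : Topology.IsQuotientMap q :=
    (IsOpenQuotientMap.piMap fun _ : d => (QuotientAddGroup.isOpenQuotientMap_mk :
      IsOpenQuotientMap (fun x : ℝ => (x : UnitAddCircle)))).isQuotientMap
  have hfac : Function.FactorsThrough F q := by
    intro x y hxy
    have : ∀ i, ∃ k : ℤ, x i = y i + k := by
      intro i
      have := congrFun hxy i
      have h0 : ((x i - y i : ℝ) : UnitAddCircle) = 0 := by
        rw [AddCircle.coe_sub, sub_eq_zero]
        exact this
      obtain ⟨k, hk⟩ := (AddCircle.coe_eq_zero_iff 1).1 h0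
      exact ⟨k, by rw [zsmul_eq_mul, mul_one] at hk; linarith⟩
    choose k hk using this
    rw [← hper y k]
    exact congrArg F (funext hk)
  let G : C(UnitAddTorus d, ℂ) := hq.lift ⟨F, hF⟩ hfac
  have hGq : ∀ x, G (q x) = F x := fun x =>
    DFunLike.congr_fun (hq.lift_comp ⟨F, hF⟩ hfac) x
  rw [← hGq, ← hGq]
  refine UnitAddTorus.eq_of_invariant_of_nonresonant G ω hω (fun t y => ?_) _ _
  obtain ⟨x, rfl⟩ := hq.surjective y
  rw [hGq, ← hinv t x, ← hGq]
  rfl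

/-! ### Symplectic linear algebra and Hamilton's equations. -/

theorem symplecticForm_right_injective {u u' : Phase}
    (h : ∀ w, symplecticForm u w = symplecticForm u' w) : u = u' := by
  simp only [symplecticForm] at h
  refine Prod.ext (ext_inner_right ℝ fun w => ?_) (ext_inner_right ℝ fun w => ?_)
  · simpa using h (0, w)
  · simpa using h (w, 0)

theorem LinearMap.bijective_of_symplectic (L : Phase →ₗ[ℝ] Phase)
    (hL : ∀ u w, symplecticForm (L u) (L w) = symplecticForm u w) : Function.Bijective L := by
  have hinj : Function.Injective L := fun u u' h =>
    symplecticForm_right_injective fun w => by rw [← hL, h, hL]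
  exact ⟨hinj, LinearMap.injective_iff_surjective.1 hinj⟩

/-- If three independent linear functionals vanish on the image of the angle directions under a
symplectic map, then their common kernel is isotropic. -/
theorem symplecticForm_eq_zero_of_mem_ker (L : Phase →ₗ[ℝ] Phase)
    (hL : ∀ u w, symplecticForm (L u) (L w) = symplecticForm u w)
    (K : Phase →ₗ[ℝ] (Fin 3 → ℝ)) (hK : Function.Surjective K) (hKL : ∀ a, K (L (a, 0)) = 0)
    {u w : Phase} (hu : K u = 0) (hw : K w = 0) : symplecticForm u w = 0 := by
  have hsurj := (LinearMap.bijective_of_symplectic L hL).2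
  -- `K ∘ L` depends on the action component only, through `M`. By dimension the surjective `M` is
  -- injective, so the kernel of `K` is the image of the angle directions.
  let M : Space3 →ₗ[ℝ] (Fin 3 → ℝ) := K ∘ₗ L ∘ₗ LinearMap.inr ℝ Space3 Space3
  have hM : ∀ a b, K (L (a, b)) = M b := fun a b => by
    have : ((a, b) : Phase) = (a, 0) + (0, b) := by simp
    rw [this, map_add, map_add, hKL, zero_add]
    rfl
  have hMs : Function.Surjective M := fun y => by
    obtain ⟨p, rfl⟩ := hK y
    obtain ⟨⟨a, b⟩, rfl⟩ := hsurj p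
    exact ⟨b, (hM a b).symm⟩
  have hMi : Function.Injective M :=
    (LinearMap.injective_iff_surjective_of_finrank_eq_finrank (by simp)).2 hMs
  have key : ∀ p, K p = 0 → ∃ a, L (a, 0) = p := fun p hp => by
    obtain ⟨⟨a, b⟩, rfl⟩ := hsurj p
    have : b = 0 := hMi (by rw [← hM a b, hp, map_zero])
    exact ⟨a, by rw [this]⟩
  obtain ⟨a, rfl⟩ := key u hu
  obtain ⟨b, rfl⟩ := key w hw
  rw [hL]
  simp [symplecticForm]

/-- Hamilton's equations without coordinates: the phase velocity represents `dE` through the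
symplectic form. -/
theorem hasFDerivAt_energy {Φ : Space3 → ℝ} {p : Phase} (hΦ : DifferentiableAt ℝ Φ p.1) :
    ∃ E' : Phase →L[ℝ] ℝ, HasFDerivAt (energy Φ) E' p ∧
      ∀ w, E' w = symplecticForm (p.2, -gradient Φ p.1) w := by
  have h1 : HasFDerivAt (fun q : Phase => q.2) (ContinuousLinearMap.snd ℝ Space3 Space3) p :=
    hasFDerivAt_snd
  have h2 : HasFDerivAt (fun q : Phase => Φ q.1)
      ((fderiv ℝ Φ p.1).comp (ContinuousLinearMap.fst ℝ Space3 Space3)) p :=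
    hΦ.hasFDerivAt.comp p hasFDerivAt_fst
  refine ⟨_, ((h1.inner ℝ h1).const_mul (1 / 2 : ℝ)).add h2, fun w => ?_⟩
  simp only [symplecticForm, inner_neg_left, inner_gradient_left]
  simp [real_inner_comm]
  ring

/-! ### Integrals of motion on invariant tori. -/

namespace ActionAngleChart

variable {Φ : Space3 → ℝ} {Ω : Set Phase} (A : ActionAngleChart Φ Ω)

theorem domain_mem_nhds (θ : Space3) {J : Space3} (hJ : J ∈ A.actions) :
    Set.univ ×ˢ A.actions ∈ nhds ((θ, J) : Phase) :=
  (isOpen_univ.prod A.isOpen_actions).mem_nhds ⟨trivial, hJ⟩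

theorem differentiableAt_toPhase (θ : Space3) {J : Space3} (hJ : J ∈ A.actions) :
    DifferentiableAt ℝ A.toPhase (θ, J) :=
  (A.contDiffOn.contDiffAt (A.domain_mem_nhds θ hJ)).differentiableAt one_ne_zero

theorem continuous_toPhase {J : Space3} (hJ : J ∈ A.actions) :
    Continuous fun θ => A.toPhase (θ, J) :=
  continuous_iff_continuousAt.2 fun θ =>
    ContinuousAt.comp (f := fun θ => ((θ, J) : Phase))
      (A.differentiableAt_toPhase θ hJ).continuousAt (by fun_prop)

/-- The chart carries the linear flow on a torus to the motion in the potential. -/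
theorem fderiv_toPhase_frequency (hΦ : Differentiable ℝ Φ) (θ : Space3) {J : Space3}
    (hJ : J ∈ A.actions) :
    fderiv ℝ A.toPhase (θ, J) (A.frequency J, 0) =
      ((A.toPhase (θ, J)).2, -gradient Φ (A.toPhase (θ, J)).1) := by
  obtain ⟨E', hE, hE'⟩ := hasFDerivAt_energy (hΦ (A.toPhase (θ, J)).1)
  have hT := (A.differentiableAt_toPhase θ hJ).hasFDerivAt
  have hET := hE.comp ((θ, J) : Phase) hT
  -- The chart postulates no regularity of `energyOfActions`; it is inherited from the energy along
  -- fixed `θ`.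
  have hdiff : DifferentiableAt ℝ A.energyOfActions J := by
    have h1 : DifferentiableAt ℝ (fun J' => energy Φ (A.toPhase (θ, J'))) J :=
      (hET.comp J (hasFDerivAt_prodMk_right θ J)).differentiableAt
    refine h1.congr_of_eventuallyEq ?_
    filter_upwards [A.isOpen_actions.mem_nhds hJ] with J' hJ'
    exact (A.energy_eq θ J' hJ').symm
  have h2 : HasFDerivAt (energy Φ ∘ A.toPhase)
      ((fderiv ℝ A.energyOfActions J).comp (ContinuousLinearMap.snd ℝ Space3 Space3)) (θ, J) := by
    have h3 : HasFDerivAt (fun q : Phase => A.energyOfActions q.2)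
      ((fderiv ℝ A.energyOfActions J).comp (ContinuousLinearMap.snd ℝ Space3 Space3)) (θ, J) :=
      HasFDerivAt.comp (g := A.energyOfActions) ((θ, J) : Phase) hdiff.hasFDerivAt hasFDerivAt_snd
    refine h3.congr_of_eventuallyEq ?_
    filter_upwards [A.domain_mem_nhds θ hJ] with q hq
    exact A.energy_eq q.1 q.2 hq.2
  have h4 := hET.unique h2
  -- By nondegeneracy it suffices to pair with vectors `dT w`; canonicity then reduces the left side
  -- to `dE(J)` applied to the action part of `w`.
  refine symplecticForm_right_injective fun w => ?_
  obtain ⟨w, rfl⟩ := (LinearMap.bijective_of_symplectic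
    (fderiv ℝ A.toPhase (θ, J)).toLinearMap (A.canonical θ J hJ)).2 w
  have h5 := DFunLike.congr_fun h4 w
  rw [ContinuousLinearMap.comp_apply, hE'] at h5
  refine (A.canonical θ J hJ _ _).trans (Eq.trans ?_ h5.symm)
  simp [symplecticForm, frequency, inner_gradient_left]

/-- A differentiable integral of motion is constant on nonresonant tori. -/
theorem eq_on_torus_of_integral (hΩ : IsOpen Ω) (hΦ : Differentiable ℝ Φ) {R : Phase → ℝ}
    (hR : DifferentiableOn ℝ R Ω) (hflow : ∀ p ∈ Ω, fderiv ℝ R p (p.2, -gradient Φ p.1) = 0)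
    {J : Space3} (hJ : J ∈ A.actions) (hω : Nonresonant (A.frequency J)) (θ θ' : Space3) :
    R (A.toPhase (θ, J)) = R (A.toPhase (θ', J)) := by
  have hpi : (2 * Real.pi : ℝ) ≠ 0 := by positivity
  have hRT : ∀ θ, HasFDerivAt (R ∘ A.toPhase)
      ((fderiv ℝ R (A.toPhase (θ, J))).comp (fderiv ℝ A.toPhase (θ, J))) (θ, J) := fun θ =>
    ((hR.differentiableAt (hΩ.mem_nhds (A.mapsTo θ J hJ))).hasFDerivAt).comp _
      (A.differentiableAt_toPhase θ hJ).hasFDerivAt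
  have hline : ∀ (θ : Space3) (t : ℝ),
      R (A.toPhase (θ + t • A.frequency J, J)) = R (A.toPhase (θ, J)) := by
    intro θ t
    have hderiv : ∀ s : ℝ, HasDerivAt (fun s : ℝ => R (A.toPhase (θ + s • A.frequency J, J))) 0 s := by
      intro s
      have hc : HasDerivAt (fun s : ℝ => ((θ + s • A.frequency J, J) : Phase))
          (A.frequency J, 0) s := by
        refine HasDerivAt.prodMk ?_ (hasDerivAt_const s J)
        simpa using ((hasDerivAt_id s).smul_const (A.frequency J)).const_add θ
      have := (hRT (θ + s • A.frequency J)).comp_hasDerivAt s hc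
      rw [ContinuousLinearMap.comp_apply, A.fderiv_toPhase_frequency hΦ _ hJ,
        hflow _ (A.mapsTo _ J hJ)] at this
      exact this
    have := is_const_of_deriv_eq_zero (fun s => (hderiv s).differentiableAt)
      (fun s => (hderiv s).deriv) t 0
    simpa using this
  -- Rescaling by `2π` turns the period lattice of the angles into `ℤ³`; time `t` in `x` is time
  -- `2πt` in the angles.
  let e : (Fin 3 → ℝ) → Space3 := fun x => WithLp.toLp 2 fun i => 2 * Real.pi * x i
  have he : Continuous e := by fun_prop
  have hcont : Continuous fun x => ((R (A.toPhase (e x, J)) : ℝ) : ℂ) := by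
    refine Complex.continuous_ofReal.comp (continuous_iff_continuousAt.2 fun x => ?_)
    have h1 : ContinuousAt R (A.toPhase (e x, J)) :=
      (hR.differentiableAt (hΩ.mem_nhds (A.mapsTo _ J hJ))).continuousAt
    exact ContinuousAt.comp (f := fun x => A.toPhase (e x, J)) h1
      ((A.continuous_toPhase hJ).comp he).continuousAt
  have key := eq_of_periodic_of_invariant_of_nonresonant _ hcont
    (fun x k => by
      have : A.toPhase (e x, J) = A.toPhase (e (fun i => x i + k i), J) :=
        (A.torus _ _ J hJ J hJ).2 ⟨rfl, k, fun i => by simp [e]; ring⟩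
      simp only [this])
    (A.frequency J) hω
    (fun t x => by
      have : e (fun i => x i + t * A.frequency J i) =
          e x + (2 * Real.pi * t) • A.frequency J := by
        ext i
        simp [e]
        ring
      simp only [this, hline])
    (fun i => θ i / (2 * Real.pi)) (fun i => θ' i / (2 * Real.pi))
  have hinv : ∀ θ : Space3, e (fun i => θ i / (2 * Real.pi)) = θ := fun θ => by
    ext i
    simp only [e]
    field_simp
  simpa only [hinv, Complex.ofReal_inj] using key

/-- The differential of an integral of motion vanishes along nonresonant tori. -/
theorem fderiv_integral_toPhase_angle (hΩ : IsOpen Ω) (hΦ : Differentiable ℝ Φ) {R : Phase → ℝ}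
    (hR : DifferentiableOn ℝ R Ω) (hflow : ∀ p ∈ Ω, fderiv ℝ R p (p.2, -gradient Φ p.1) = 0)
    {J : Space3} (hJ : J ∈ A.actions) (hω : Nonresonant (A.frequency J)) (θ a : Space3) :
    fderiv ℝ R (A.toPhase (θ, J)) (fderiv ℝ A.toPhase (θ, J) (a, 0)) = 0 := by
  have h1 : HasFDerivAt (fun θ' => R (A.toPhase (θ', J)))
      (((fderiv ℝ R (A.toPhase (θ, J))).comp (fderiv ℝ A.toPhase (θ, J))).comp
        (ContinuousLinearMap.inl ℝ Space3 Space3)) θ :=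
    HasFDerivAt.comp (g := R ∘ A.toPhase) θ (((hR.differentiableAt (hΩ.mem_nhds (A.mapsTo θ J hJ))).hasFDerivAt).comp ((θ, J) : Phase)
      (A.differentiableAt_toPhase θ hJ).hasFDerivAt) (hasFDerivAt_prodMk_left θ J)
  have h2 : (fun θ' => R (A.toPhase (θ', J))) = fun _ => R (A.toPhase (θ, J)) :=
    funext fun θ' => A.eq_on_torus_of_integral hΩ hΦ hR hflow hJ hω θ' θ
  rw [h2] at h1
  simpa using DFunLike.congr_fun (h1.unique (hasFDerivAt_const _ _)) a

end ActionAngleChart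

/-! ### Differentials of ratios and their independence. -/

theorem fderiv_div_apply {E : Type*} [NormedAddCommGroup E] [NormedSpace ℝ E] {a b : E → ℝ} {p : E}
    (ha : DifferentiableAt ℝ a p) (hb : DifferentiableAt ℝ b p) (h0 : b p ≠ 0) (w : E) :
    b p ^ 2 * fderiv ℝ (fun q => a q / b q) p w = b p * fderiv ℝ a p w - a p * fderiv ℝ b p w := by
  have h := (ha.hasFDerivAt.mul ((hasDerivAt_inv h0).comp_hasFDerivAt p hb.hasFDerivAt)).fderiv
  have h' : (fun q => a q / b q) = a * ((fun x => x⁻¹) ∘ b) := funext fun q => div_eq_mul_inv _ _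
  rw [h', h]
  simp
  field_simp
  ring

theorem linearIndependent_fderiv_ratio {f : Fin 4 → Phase → ℝ} {p : Phase}
    (hd : ∀ i, DifferentiableAt ℝ (f i) p) (h0 : f 0 p ≠ 0) (hf : IndependentAt f p) :
    LinearIndependent ℝ fun i : Fin 3 => fderiv ℝ (fun q => f i.succ q / f 0 q) p := by
  rw [Fintype.linearIndependent_iff]
  intro c hc
  rw [IndependentAt, Fintype.linearIndependent_iff] at hf
  have hc' : ∑ i, c i • (f 0 p • fderiv ℝ (f i.succ) p - f i.succ p • fderiv ℝ (f 0) p) = 0 := by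
    refine ContinuousLinearMap.ext fun w => ?_
    have := congrArg (f 0 p ^ 2 * ·) (DFunLike.congr_fun hc w)
    simp only [sum_apply, smul_apply, Finset.mul_sum,
      smul_eq_mul, zero_apply, mul_zero, sub_apply] at this ⊢
    rw [← this]
    refine Finset.sum_congr rfl fun i _ => ?_
    rw [← fderiv_div_apply (hd _) (hd 0) h0]
    ring
  -- The coefficient of `f 0` makes the combination vanish at `p`; its differential is then the sum
  -- in `hc'`.
  have h := hf (Fin.cons (-∑ i, c i * f i.succ p) fun i => c i * f 0 p) (by
    rw [Fin.sum_univ_succ]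
    simp only [Fin.cons_zero, Fin.cons_succ]
    refine Prod.ext ?_ ?_
    · simp only [Prod.fst_add, Prod.fst_sum, Prod.smul_fst, smul_eq_mul, Prod.fst_zero, neg_mul,
        Finset.sum_mul]
      rw [neg_add_eq_zero]
      exact Finset.sum_congr rfl fun i _ => by ring
    · simp only [Prod.snd_add, Prod.snd_sum, Prod.smul_snd, Prod.snd_zero]
      rw [← hc']
      simp only [smul_sub, Finset.sum_sub_distrib, smul_smul, ← Finset.sum_smul, neg_smul]
      abel)
  intro i
  have := h i.succ
  rw [Fin.cons_succ] at this
  exact (mul_eq_zero.1 this).resolve_right h0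

/-- By duality: a functional vanishing on the range is a linear relation among the `φ i`. -/
theorem LinearIndependent.surjective_pi {ι V : Type*} [Fintype ι] [DecidableEq ι]
    [AddCommGroup V] [Module ℝ V] {φ : ι → V →ₗ[ℝ] ℝ} (hφ : LinearIndependent ℝ φ) :
    Function.Surjective (LinearMap.pi φ) := by
  rw [← LinearMap.dualMap_injective_iff, injective_iff_map_eq_zero]
  intro l hl
  rw [Fintype.linearIndependent_iff] at hφ
  have hsum : ∑ i, l (Pi.single i 1) • φ i = 0 := by
    ext v
    have := DFunLike.congr_fun hl v
    rw [LinearMap.dualMap_apply, LinearMap.pi_apply_eq_sum_univ l] at this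
    simp only [LinearMap.zero_apply, LinearMap.pi_apply, smul_eq_mul] at this
    simp only [LinearMap.sum_apply, LinearMap.smul_apply, smul_eq_mul, LinearMap.zero_apply]
    rw [← this]
    refine Finset.sum_congr rfl fun i _ => ?_
    rw [mul_comm]
    congr 2
    ext j
    simp [Pi.single_apply, eq_comm]
  refine LinearMap.pi_ext' fun i => LinearMap.ext_ring ?_
  simpa using hφ _ hsum i

/-! ### Ratios of biased families and the force they determine. -/

namespace IsBiasedFamily

variable {Ω : Set Phase} {Φ : Space3 → ℝ} {γ : Phase → ℝ} {f g : Fin 4 → Phase → ℝ}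

theorem pos_distribution (h : IsBiasedFamily Ω Φ γ f g) (i : Fin 4) {p : Phase} (hp : p ∈ Ω) :
    0 < f i p := by
  have h1 := h.pos i p hp
  rw [h.product i p hp] at h1
  exact (pos_iff_pos_of_mul_pos h1).1 (h.bias p hp).1

theorem ratio_eq (h : IsBiasedFamily Ω Φ γ f g) (i : Fin 4) {p : Phase} (hp : p ∈ Ω) :
    g i p / g 0 p = f i p / f 0 p := by
  rw [h.product i p hp, h.product 0 p hp, mul_div_mul_left _ _ (h.bias p hp).1.ne']

theorem differentiable_potential (h : IsBiasedFamily Ω Φ γ f g) : Differentiable ℝ Φ :=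
  h.potential.differentiable one_ne_zero

theorem differentiableAt_distribution (h : IsBiasedFamily Ω Φ γ f g) (hΩ : IsOpen Ω) (i : Fin 4)
    {p : Phase} (hp : p ∈ Ω) : DifferentiableAt ℝ (f i) p :=
  ((h.steady i).contDiffOn.contDiffAt (hΩ.mem_nhds hp)).differentiableAt one_ne_zero

theorem differentiableOn_ratio (h : IsBiasedFamily Ω Φ γ f g) (hΩ : IsOpen Ω) (i : Fin 4) :
    DifferentiableOn ℝ (fun q => f i q / f 0 q) Ω := fun _ hp => by
  simp only [div_eq_mul_inv]
  exact ((h.differentiableAt_distribution hΩ i hp).fun_mul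
    ((h.differentiableAt_distribution hΩ 0 hp).fun_inv
      (h.pos_distribution 0 hp).ne')).differentiableWithinAt

theorem fderiv_ratio_flow (h : IsBiasedFamily Ω Φ γ f g) (hΩ : IsOpen Ω) (i : Fin 4)
    {p : Phase} (hp : p ∈ Ω) :
    fderiv ℝ (fun q => f i q / f 0 q) p (p.2, -gradient Φ p.1) = 0 := by
  have h0 := (h.pos_distribution 0 hp).ne'
  have := fderiv_div_apply (h.differentiableAt_distribution hΩ i hp)
    (h.differentiableAt_distribution hΩ 0 hp) h0 (p.2, -gradient Φ p.1)
  rw [(h.steady i).boltzmann p hp, (h.steady 0).boltzmann p hp, mul_zero, mul_zero, sub_zero] at this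
  exact (mul_eq_zero.1 this).resolve_left (pow_ne_zero 2 h0)

/-- Values and differentials of the `f i` vary continuously, and linear independence is an open
condition. -/
theorem isOpen_setOf_independentAt (h : IsBiasedFamily Ω Φ γ f g) (hΩ : IsOpen Ω) :
    IsOpen (Ω ∩ {p | IndependentAt f p}) := by
  have hc : ContinuousOn (fun p => fun i => ((f i p, fderiv ℝ (f i) p) : ℝ × (Phase →L[ℝ] ℝ))) Ω :=
    continuousOn_pi.2 fun i => (h.steady i).contDiffOn.continuousOn.prodMk
      ((h.steady i).contDiffOn.continuousOn_fderiv_of_isOpen hΩ le_rfl)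
  exact hc.isOpen_inter_preimage hΩ isOpen_setOfPred_linearIndependent

/-- At a point of a nonresonant torus where the distribution functions are independent, any force
under whose motion the ratios are conserved differs from the true one by a vector orthogonal to
the velocity. -/
theorem inner_force_sub_eq_zero (h : IsBiasedFamily Ω Φ γ f g) (hΩ : IsOpen Ω)
    (A : ActionAngleChart Φ Ω) (θ : Space3) {J : Space3} (hJ : J ∈ A.actions)
    (hω : Nonresonant (A.frequency J)) {p : Phase} (hp : A.toPhase (θ, J) = p)
    (hind : IndependentAt f p) (b : Space3)
    (hb : ∀ i : Fin 3, fderiv ℝ (fun q => f i.succ q / f 0 q) p (p.2, -b) = 0) :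
    inner ℝ (b - gradient Φ p.1) p.2 = 0 := by
  have hpΩ : p ∈ Ω := hp ▸ A.mapsTo θ J hJ
  have hli := linearIndependent_fderiv_ratio
    (fun i => h.differentiableAt_distribution hΩ i hpΩ) (h.pos_distribution 0 hpΩ).ne' hind
  have hli' : LinearIndependent ℝ fun i : Fin 3 =>
      (fderiv ℝ (fun q => f i.succ q / f 0 q) p).toLinearMap :=
    hli.map' (ContinuousLinearMap.coeLM ℝ : (Phase →L[ℝ] ℝ) →ₗ[ℝ] Phase →ₗ[ℝ] ℝ)
      (LinearMap.ker_eq_bot.2 ContinuousLinearMap.coe_injective)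
  have key := symplecticForm_eq_zero_of_mem_ker (fderiv ℝ A.toPhase (θ, J)).toLinearMap
    (A.canonical θ J hJ) _ hli'.surjective_pi
    (fun a => funext fun i => by
      subst hp
      exact A.fderiv_integral_toPhase_angle hΩ h.differentiable_potential
        (h.differentiableOn_ratio hΩ i.succ) (fun q hq => h.fderiv_ratio_flow hΩ i.succ hq)
        hJ hω θ a)
    (u := (p.2, -b)) (w := (p.2, -gradient Φ p.1))
    (funext fun i => hb i) (funext fun i => h.fderiv_ratio_flow hΩ i.succ hpΩ)
  simp only [symplecticForm, inner_neg_right, inner_neg_left] at key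
  rw [inner_sub_left, real_inner_comm (p.2) (gradient Φ p.1)]
  linarith

end IsBiasedFamily

/-- Test with `w = v + s • u` for a small `s ≠ 0`: the difference from `w = v` is `s|u|²`. -/
theorem eq_zero_of_eventually_inner_eq_zero {E : Type*} [NormedAddCommGroup E]
    [InnerProductSpace ℝ E] {u v : E} (h : ∀ᶠ w in nhds v, inner ℝ u w = 0) : u = 0 := by
  have hc : Filter.Tendsto (fun s : ℝ => v + s • u) (nhdsWithin 0 {0}ᶜ) (nhds v) := by
    refine Filter.Tendsto.mono_left ?_ nhdsWithin_le_nhds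
    have : Continuous fun s : ℝ => v + s • u := by fun_prop
    simpa using this.tendsto 0
  obtain ⟨s, hs, hs0⟩ := ((hc.eventually h).and self_mem_nhdsWithin).exists
  rw [inner_add_right, h.self_of_nhds, inner_smul_right, zero_add] at hs
  exact inner_self_eq_zero.1 ((mul_eq_zero.1 hs).resolve_left hs0)

theorem theorem2
    (Ω : Set Phase) (hΩ : IsOpen Ω) (hconn : IsPreconnected (accessible Ω))
    (Φ : Space3 → ℝ) (γ : Phase → ℝ) (f g : Fin 4 → Phase → ℝ)
    (h : IsBiasedFamily Ω Φ γ f g)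
    (hind : accessible Ω ⊆ closure {x | ∃ v, (x, v) ∈ Ω ∧ IndependentAt f (x, v)}) :
    -- the ratios are free of the bias
    (∀ i : Fin 3, ∀ p ∈ Ω, g i.succ p / g 0 p = f i.succ p / f 0 p) ∧
    -- they are functions of the isolating integrals
    (∀ A : ActionAngleChart Φ Ω, ∃ F : Fin 3 → Space3 → ℝ,
      ∀ J ∈ A.actions, Nonresonant (A.frequency J) → ∀ θ : Space3, ∀ i : Fin 3,
        g i.succ (A.toPhase (θ, J)) / g 0 (A.toPhase (θ, J)) = F i J) ∧
    -- they determine the potential up to an additive constant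
    (∀ (Ψ : Space3 → ℝ) (γ' : Phase → ℝ) (f' g' : Fin 4 → Phase → ℝ),
      IsBiasedFamily Ω Ψ γ' f' g' →
      (∀ i : Fin 3, ∀ p ∈ Ω, g' i.succ p / g' 0 p = g i.succ p / g 0 p) →
      ∃ c : ℝ, ∀ x ∈ accessible Ω, Ψ x = Φ x + c) := by
  refine ⟨fun i p hp => h.ratio_eq i.succ hp, fun A => ?_, ?_⟩
  · refine ⟨fun i J => f i.succ (A.toPhase (0, J)) / f 0 (A.toPhase (0, J)),
      fun J hJ hω θ i => ?_⟩
    rw [h.ratio_eq i.succ (A.mapsTo θ J hJ)]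
    exact A.eq_on_torus_of_integral hΩ h.differentiable_potential
      (h.differentiableOn_ratio hΩ i.succ) (fun q hq => h.fderiv_ratio_flow hΩ i.succ hq)
      hJ hω θ 0
  · intro Ψ γ' f' g' h' hratio
    -- The shared ratios are also integrals of the motion in `Ψ`.
    have hflow : ∀ i : Fin 3, ∀ p ∈ Ω,
        fderiv ℝ (fun q => f i.succ q / f 0 q) p (p.2, -gradient Ψ p.1) = 0 := by
      intro i p hp
      have heq : (fun q => f i.succ q / f 0 q) =ᶠ[nhds p] fun q => f' i.succ q / f' 0 q := by
        filter_upwards [hΩ.mem_nhds hp] with q hq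
        rw [← h.ratio_eq i.succ hq, ← hratio i q hq, h'.ratio_eq i.succ hq]
      rw [heq.fderiv_eq, h'.fderiv_ratio_flow hΩ i.succ hp]
    have hgrad : ∀ {V : Space3 → ℝ}, ContDiff ℝ 1 V → Continuous (gradient V) := fun hV =>
      (InnerProductSpace.toDual ℝ Space3).symm.continuous.comp (hV.continuous_fderiv one_ne_zero)
    have hΦc := hgrad h.potential
    have hΨc := hgrad h'.potential
    set U := Ω ∩ {p | IndependentAt f p} with hU
    have hUo : IsOpen U := h.isOpen_setOf_independentAt hΩ
    have horth : ∀ p ∈ U, inner ℝ (gradient Ψ p.1 - gradient Φ p.1) p.2 = 0 := by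
      have hclosed : IsClosed {p : Phase | inner ℝ (gradient Ψ p.1 - gradient Φ p.1) p.2 = 0} :=
        isClosed_eq (((hΨc.comp continuous_fst).sub (hΦc.comp continuous_fst)).inner
          continuous_snd) continuous_const
      have hdense := Measure.dense_of_ae h.integrable
      intro p hp
      -- A conull set is dense, so points on nonresonant tori are dense in the open set `U`, and the
      -- closed condition extends to all of `U`.
      refine closure_minimal ?_ hclosed (hdense.open_subset_closure_inter hUo hp)
      rintro q ⟨hqU, hq⟩
      obtain ⟨A, θ, J, hJ, hω, hT⟩ := hq hqU.1
      exact h.inner_force_sub_eq_zero hΩ A θ hJ hω hT hqU.2 _ fun i => hflow i q hqU.1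
    have hzero : ∀ x ∈ accessible Ω, gradient Ψ x = gradient Φ x := by
      refine hind.trans (closure_minimal ?_ (isClosed_eq hΨc hΦc))
      rintro x ⟨v, hv⟩
      refine sub_eq_zero.1 (eq_zero_of_eventually_inner_eq_zero (v := v) ?_)
      have : ∀ᶠ w in nhds v, (x, w) ∈ U :=
        (Continuous.prodMk_right x).continuousAt.eventually (hUo.mem_nhds hv)
      filter_upwards [this] with w hw
      exact horth (x, w) hw
    have hopen : IsOpen (accessible Ω) := isOpenMap_fst _ hΩ
    refine hopen.exists_eq_add_of_fderiv_eq hconn h'.differentiable_potential.differentiableOn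
      h.differentiable_potential.differentiableOn fun x hx => ?_
    rw [← toDual_gradient, hzero x hx, toDual_gradient]
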